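/- For an integer $n\ge 0$, a matching on $[2n]=\{1,\dots,2n\}$ is a set partition of $[2n]$ into $n$ two-element blocks (edges); $\mathcal M(n)$ is the set of all of them, with $\mathcal M(0)=\{\emptyset\}$. Two edges $A,B$ cross if $\min A<\min B<\max A<\max B$ or $\min B<\min A<\max B<\max A$, and $cr(M)$ is the number of (unordered) pairs of crossing edges of $M$. A child of $M\in\mathcal M(n)$ is a matching in $\mathcal M(n+1)$ that arises from $M$ by adding a new first edge: for some $x\in\{2,\dots,2n+2\}$ one relabels the vertices of $M$ increasingly as the elements of $\{2,\dots,2n+2\}\setminus\{x\}$ and adds the edge $\{1,x\}$. Let $\mathcal T(M,0)=\{M\}$ and, for $l\ge 0$, let $\mathcal T(M,l+1)$ be the set of all children of the elements of $\mathcal T(M,l)$. Matchings $M,N\in\mathcal M(n)$ are called crossing-similar, $M\sim_{cr}N$, if for all integers $l\ge 0$ and $k\ge 0$ $$|\{K\in\mathcal T(M,l):\ cr(K)=k\}|=|\{K\in\mathcal T(N,l):\ cr(K)=k\}|.$$ This is an equivalence relation on $\mathcal M(n)$. **Theorem.** For every integer $n\ge 1$, $$\bigl|\mathcal M(n)/\!\sim_{cr}\bigr|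 = 2^{n-2}\left(\binom n2+2\right).$$ -/

import Mathlib

/-- A matching on `[2n]`: a set partition of a linearly ordered set with `2n` elements (here
`Fin (2 * n)`, that is, `{0, …, 2n-1}` instead of `{1, …, 2n}`) all of whose blocks, called edges,
have two elements. For `n = 0` there is exactly one, the empty matching. -/
@[ext]
structure Matching (n : ℕ) where
  /-- the underlying set partition -/
  partition : Finpartition (Finset.univ : Finset (Fin (2 * n)))
  card_eq_two : ∀ A ∈ partition.parts, A.card = 2

namespace Matching

/-- The set of edges of a matching. -/
def edges {n : ℕ} (M : Matching n) : Finset (Finset (Fin (2 * n))) := M.partition.parts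

/-- `A` and `B` cross, with `A` starting first: `min A < min B < max A < max B`. -/
def CrossesFromLeft {m : ℕ} (A B : Finset (Fin m)) : Prop :=
  ∃ a b c d : Fin m, IsLeast (A : Set (Fin m)) a ∧ IsLeast (B : Set (Fin m)) b ∧
    IsGreatest (A : Set (Fin m)) c ∧ IsGreatest (B : Set (Fin m)) d ∧ a < b ∧ b < c ∧ c < d

/-- The number `cr(M)` of crossings of `M`. Every crossing, an unordered pair of edges, is counted
once, since exactly one of its two orderings starts with the edge with the smaller minimum. -/
noncomputable def cr {n : ℕ} (M : Matching n) : ℕ :=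
  {p : Finset (Fin (2 * n)) × Finset (Fin (2 * n)) |
    p.1 ∈ M.edges ∧ p.2 ∈ M.edges ∧ CrossesFromLeft p.1 p.2}.ncard

/-- `N` is a child of `M` in the tree of matchings: `N` arises from `M` by adding a new first edge
`{0, x}`, the vertices of `M` being relabelled increasingly by the remaining elements. -/
def IsChild {n : ℕ} (M : Matching n) (N : Matching (n + 1)) : Prop :=
  ∃ (x : Fin (2 * (n + 1))) (φ : Fin (2 * n) ↪o Fin (2 * (n + 1))),
    x ≠ 0 ∧ Set.range φ = {0, x}ᶜ ∧
    N.edges = insert {0, x} (M.edges.image (Finset.image φ))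

/-- The `l`-th level of the subtree, rooted in `M`, of the tree of matchings. -/
def level {n : ℕ} (M : Matching n) : (l : ℕ) → Set (Matching (n + l))
  | 0 => {M}
  | l + 1 => {N | ∃ K ∈ level M l, IsChild K N}

/-- Crossing-similarity: for every `l`, `cr` has the same distribution (the same multiset of
values) on the `l`-th levels of the subtrees rooted in `M` and in `N`. -/
def CrossingSimilar {n : ℕ} (M N : Matching n) : Prop :=
  ∀ l k : ℕ, {K ∈ level M l | cr K = k}.ncard = {K ∈ level N l | cr K = k}.ncard

/-- Crossing-similarity as an equivalence relation on the matchings on `[2n]`. -/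
def crossingSetoid (n : ℕ) : Setoid (Matching n) where
  r := CrossingSimilar
  iseqv :=
    { refl := fun _ _ _ => rfl
      symm := fun h l k => (h l k).symm
      trans := fun h₁ h₂ l k => (h₁ l k).trans (h₂ l k) }

end Matching

/-! Record a matching by the heights of its 2n+1 gaps, a gap's height being the number of edges
covering it. These heights form a Dyck path. Ending the new first edge in gap i adds as many
crossings as the height a_i of that gap, and turns the height sequence L into `0 :: liftAt L i`.
Hence the crossing distributions on all levels depend only on `cr M` and the height sequence.

The order of the heights is irrelevant. The operator `childSum` sends the complete homogeneous
polynomials h_k in the q^a (a in L) to combinations of such polynomials, by the telescoping identity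
`homSeries_liftAt`. Every level polynomial is thus symmetric in L. Conversely, level 0 reveals `cr
M` and level 1 the multiset of heights, so these two data classify matchings up to similarity
(`crossingSimilar_iff`).

It remains to count the pairs. Removing a highest peak shows that the height multisets double in
number with each semilength (`raise`, `widen`). For a path of semilength n with height sum n + 2m,
the crossing numbers that occur are exactly 0, …, m (`exists_heights_eq_cons`, `exists_heights_eq`).
Summing m + 1 over all multisets gives the formula. -/

namespace Matching

/-! ### Complete homogeneous polynomials and the symmetry of level polynomials -/

open Polynomial

/-- `liftAt a i` raises the entries `0, …, i` of `a` by one and repeats the `i`-th entry. -/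
def liftAt : List ℕ → ℕ → List ℕ
  | [], _ => []
  | x :: L, 0 => (x + 1) :: x :: L
  | x :: L, i + 1 => (x + 1) :: liftAt L i

/-- The power series `1 / (1 - q ^ a t)` in `t`, where `q` is the polynomial variable. -/
noncomputable def geomSeries (a : ℕ) : PowerSeries ℤ[X] := PowerSeries.mk fun k => X ^ (a * k)

/-- The generating function of the complete homogeneous polynomials in the `q ^ a`, `a ∈ L`. -/
noncomputable def homSeries (L : List ℕ) : PowerSeries ℤ[X] := (L.map geomSeries).prod

/-- The complete homogeneous polynomial of degree `k` in the `q ^ a`, `a ∈ L`. -/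
noncomputable def homPoly (k : ℕ) (L : List ℕ) : ℤ[X] := PowerSeries.coeff k (homSeries L)

theorem geomSeries_mul (a : ℕ) :
    geomSeries a * (1 - PowerSeries.C (X ^ a : ℤ[X]) * PowerSeries.X) = 1 := by
  ext1 k
  rw [mul_sub, mul_one, mul_left_comm, ← mul_assoc, mul_assoc]
  cases k with
  | zero => simp [geomSeries]
  | succ k =>
    rw [map_sub, PowerSeries.coeff_C_mul, PowerSeries.coeff_succ_mul_X]
    simp [geomSeries, PowerSeries.coeff_one, mul_add, pow_add, mul_comm]

theorem geomSeries_sub (a : ℕ) :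
    geomSeries a - geomSeries (a + 1) = PowerSeries.X * PowerSeries.C (1 - X : ℤ[X]) *
      (PowerSeries.C (X ^ a : ℤ[X]) * (geomSeries (a + 1) * geomSeries a)) := by
  have h1 := geomSeries_mul a
  have h2 := geomSeries_mul (a + 1)
  simp only [pow_succ, map_mul, map_sub, map_one] at h1 h2 ⊢
  linear_combination geomSeries (a + 1) * h1 - geomSeries a * h2

theorem geomSeries_succ (a : ℕ) :
    geomSeries (a + 1) = PowerSeries.rescale (X : ℤ[X]) (geomSeries a) := by
  ext1 k
  simp [geomSeries, PowerSeries.coeff_rescale, ← pow_add]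
  ring

theorem homSeries_map_succ (L : List ℕ) :
    homSeries (L.map (· + 1)) = PowerSeries.rescale (X : ℤ[X]) (homSeries L) := by
  induction L with
  | nil => simp [homSeries]
  | cons a L ih =>
    simp only [homSeries, List.map_cons, List.prod_cons, map_mul] at ih ⊢
    rw [ih, geomSeries_succ]

/-- Raise the entries of L by one, from left to right. By `geomSeries_sub`, raising entry i changes
the product by the i-th summand, in which this entry occurs both raised and unraised; the sum
telescopes. -/
theorem homSeries_liftAt (L : List ℕ) :
    PowerSeries.X * PowerSeries.C (1 - X : ℤ[X]) *
      ∑ i ∈ Finset.range L.length,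
        PowerSeries.C (X ^ L.getD i 0 : ℤ[X]) * homSeries (liftAt L i) =
      homSeries L - homSeries (L.map (· + 1)) := by
  induction L with
  | nil => simp [homSeries]
  | cons a L ih =>
    have h := geomSeries_sub a
    simp only [homSeries] at ih
    simp only [List.length_cons, Finset.sum_range_succ', homSeries, liftAt, List.map_cons,
      List.prod_cons, List.getD_cons_succ, List.getD_cons_zero]
    have e : ∀ i, PowerSeries.C (X ^ L.getD i 0 : ℤ[X]) *
        (geomSeries (a + 1) * ((liftAt L i).map geomSeries).prod) = geomSeries (a + 1) *
        (PowerSeries.C (X ^ L.getD i 0 : ℤ[X]) * ((liftAt L i).map geomSeries).prod) :=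
      fun i => by ring
    simp only [e, ← Finset.mul_sum]
    linear_combination geomSeries (a + 1) * ih - (L.map geomSeries).prod * h

/-- Raising all entries rescales t to qt, so the coefficient of t^(k+1) in `homSeries_liftAt`
carries the factor 1 - q^(k+1) on the right and 1 - q on the left; the latter cancels. -/
theorem sum_coeff_homSeries_liftAt (L : List ℕ) (k : ℕ) :
    ∑ i ∈ Finset.range L.length, X ^ L.getD i 0 * homPoly k (liftAt L i) =
      (∑ i ∈ Finset.range (k + 1), X ^ i) * homPoly (k + 1) L := by
  have h := congrArg (PowerSeries.coeff (k + 1)) (homSeries_liftAt L)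
  rw [homSeries_map_succ, mul_assoc, PowerSeries.coeff_succ_X_mul, PowerSeries.coeff_C_mul,
    map_sub, PowerSeries.coeff_rescale, map_sum] at h
  simp only [PowerSeries.coeff_C_mul] at h
  have h0 : (1 - X : ℤ[X]) ≠ 0 := by
    intro h
    simpa using congrArg (eval 0) h
  refine mul_left_cancel₀ h0 ?_
  rw [← mul_assoc, mul_neg_geom_sum]
  simp only [homPoly]
  rw [h]
  ring

/-- The sum of `q ^ a_i` times the value of `f` at the height sequence of the `i`-th child. -/
noncomputable def childSum : (List ℕ → ℤ[X]) →ₗ[ℤ[X]] (List ℕ → ℤ[X]) where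
  toFun f L := ∑ i ∈ Finset.range L.length, X ^ L.getD i 0 * f (0 :: liftAt L i)
  map_add' f g := by
    ext1 L
    simp [mul_add, Finset.sum_add_distrib]
  map_smul' c f := by
    ext1 L
    simp [Finset.mul_sum, mul_left_comm]

theorem childSum_apply (f : List ℕ → ℤ[X]) (L : List ℕ) :
    childSum f L = ∑ i ∈ Finset.range L.length, X ^ L.getD i 0 * f (0 :: liftAt L i) := rfl

/-- The height 0 in front contributes the variable q^0 = 1, so h_k of the longer list is the sum of
all h_j with j ≤ k of the lifted list. -/
theorem childSum_homPoly (k : ℕ) : childSum (homPoly k) =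
    ∑ p ∈ Finset.HasAntidiagonal.antidiagonal k, (∑ i ∈ Finset.range (p.2 + 1), X ^ i : ℤ[X]) •
      homPoly (p.2 + 1) := by
  ext1 L
  have e : ∀ i, homPoly k (0 :: liftAt L i) =
      ∑ p ∈ Finset.HasAntidiagonal.antidiagonal k, homPoly p.2 (liftAt L i) := fun i => by
    simp only [homPoly, homSeries, List.map_cons, List.prod_cons, PowerSeries.coeff_mul]
    simp [geomSeries]
  simp only [childSum_apply, e, Finset.mul_sum, Finset.sum_apply, Pi.smul_apply, smul_eq_mul,
    ← sum_coeff_homSeries_liftAt]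
  exact Finset.sum_comm

theorem childSum_mem_span {f : List ℕ → ℤ[X]}
    (hf : f ∈ Submodule.span ℤ[X] (Set.range homPoly)) :
    childSum f ∈ Submodule.span ℤ[X] (Set.range homPoly) := by
  refine (Submodule.map_span_le childSum _ _).2 ?_ (Submodule.mem_map_of_mem hf)
  rintro _ ⟨k, rfl⟩
  rw [childSum_homPoly]
  exact Submodule.sum_mem _ fun p _ =>
    Submodule.smul_mem _ _ (Submodule.subset_span ⟨_, rfl⟩)

theorem eq_of_perm_of_mem_span {f : List ℕ → ℤ[X]}
    (hf : f ∈ Submodule.span ℤ[X] (Set.range homPoly)) {L L' : List ℕ} (h : L.Perm L') :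
    f L = f L' := by
  induction hf using Submodule.span_induction with
  | mem f hf =>
    obtain ⟨k, rfl⟩ := hf
    simp only [homPoly, homSeries, (h.map geomSeries).prod_eq]
  | zero => rfl
  | add f g _ _ hf hg => simp [hf, hg]
  | smul c f _ hf => simp [hf]

/-- The generating polynomial of the number of crossings added on the first `l` levels below a
matching with height sequence `L`. -/
noncomputable def levelPoly (l : ℕ) : List ℕ → ℤ[X] := (childSum ^ l) 1

theorem levelPoly_succ (l : ℕ) : levelPoly (l + 1) = childSum (levelPoly l) := by
  simp [levelPoly, pow_succ']

theorem levelPoly_mem_span (l : ℕ) :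
    levelPoly l ∈ Submodule.span ℤ[X] (Set.range homPoly) := by
  induction l with
  | zero =>
    have h : levelPoly 0 = homPoly 0 := by
      ext1 L
      simp only [levelPoly, pow_zero, Module.End.one_apply, Pi.one_apply, homPoly, homSeries,
        PowerSeries.coeff_zero_eq_constantCoeff_apply, map_list_prod, List.map_map]
      symm
      apply List.prod_eq_one
      simp [geomSeries]
    exact h ▸ Submodule.subset_span ⟨0, rfl⟩
  | succ l ih => exact levelPoly_succ l ▸ childSum_mem_span ih

theorem levelPoly_eq_of_perm (l : ℕ) {L L' : List ℕ} (h : L.Perm L') :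
    levelPoly l L = levelPoly l L' :=
  eq_of_perm_of_mem_span (levelPoly_mem_span l) h

theorem levelPoly_one (L : List ℕ) : levelPoly 1 L = (L.map (X ^ · : ℕ → ℤ[X])).sum := by
  rw [levelPoly_succ, childSum_apply, ← Fin.sum_univ_fun_getElem, Finset.sum_range]
  exact Finset.sum_congr rfl fun i _ => by simp [levelPoly]

/-- This lets the multiset of heights be read off from level 1. -/
theorem coeff_levelPoly_one (L : List ℕ) (k : ℕ) : (levelPoly 1 L).coeff k = L.count k := by
  rw [levelPoly_one]
  induction L with
  | nil => simp
  | cons a L ih =>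
    rw [List.map_cons, List.sum_cons, coeff_add, ih, coeff_X_pow, List.count_cons]
    by_cases h : k = a
    · simp [h, add_comm]
    · simp [h, Ne.symm h]

end Matching

/-! ### Walks and the height multisets of Dyck paths -/

namespace Matching

/-- `L` lists the heights, after the start, of a walk with steps `±1` from height `h` to `0`. -/
def IsWalk : ℕ → List ℕ → Prop
  | h, [] => h = 0
  | h, x :: L => (x = h + 1 ∨ h = x + 1) ∧ IsWalk x L

theorem sum_liftAt (L : List ℕ) (i : ℕ) (hi : i < L.length) :
    (liftAt L i).sum = L.sum + L.getD i 0 + (i + 1) := by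
  induction L generalizing i with
  | nil => simp at hi
  | cons a L ih =>
    cases i with
    | zero => simp [liftAt]; ring
    | succ i =>
      have := ih i (by simpa using hi)
      simp only [liftAt, List.sum_cons, List.getD_cons_succ, this]
      ring

theorem IsWalk.getD_le {h : ℕ} {L : List ℕ} (hL : IsWalk h L) (i : ℕ) :
    (h :: L).getD i 0 ≤ h + i := by
  induction L generalizing h i with
  | nil => cases i <;> simp
  | cons a L ih =>
    cases i with
    | zero => simp
    | succ i =>
      have := ih hL.2 i
      rw [List.getD_cons_succ]
      have := hL.1
      omega

/-- The raised prefix is joined to the unchanged rest by a down step between the two copies of entry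
i. -/
theorem IsWalk.liftAt {h : ℕ} {L : List ℕ} (hL : IsWalk h L) {i : ℕ} (hi : i ≤ L.length) :
    ∃ L', liftAt (h :: L) i = (h + 1) :: L' ∧ IsWalk (h + 1) L' := by
  induction L generalizing h i with
  | nil =>
    obtain rfl : i = 0 := by simpa using hi
    exact ⟨_, rfl, by simp, hL⟩
  | cons a L ih =>
    cases i with
    | zero => exact ⟨_, rfl, by simp, hL⟩
    | succ i =>
      obtain ⟨L', h1, h2⟩ := ih hL.2 (i := i) (by simpa using hi)
      refine ⟨_, rfl, ?_⟩
      rw [h1]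
      have := hL.1
      exact ⟨by omega, h2⟩

/-- At the first visit to the maximum r both neighbours have height r - 1. Deleting the peak and its
right neighbour leaves a walk that still visits r - 1. -/
theorem IsWalk.exists_remove_peak {h r : ℕ} {L : List ℕ} (hL : IsWalk h L) (hr : r ∈ L)
    (hle : ∀ x ∈ L, x ≤ r) (hh : h < r) :
    ∃ L', IsWalk h L' ∧ L.Perm (r :: (r - 1) :: L') ∧ (r - 1) ∈ h :: L' := by
  induction L generalizing h with
  | nil => simp at hr
  | cons a L ih =>
    by_cases ha : a = r
    · subst ha
      cases L with
      | nil =>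
        have := hL.2
        simp only [IsWalk] at this
        omega
      | cons b L =>
        have h1 := hL.1
        have h2 := hL.2.1
        have h3 := hle b (by simp)
        obtain rfl : b = a - 1 := by omega
        obtain rfl : h = a - 1 := by omega
        exact ⟨L, hL.2.2, .refl _, by simp⟩
    · have ha' : a < r := lt_of_le_of_ne (hle a (by simp)) ha
      obtain ⟨L', h1, h2, h3⟩ := ih hL.2 (by simpa [Ne.symm ha] using hr)
        (fun x hx => hle x (by simp [hx])) ha'
      exact ⟨a :: L', ⟨hL.1, h1⟩, (h2.cons a).trans
        ((List.Perm.swap _ _ _).trans ((List.Perm.swap _ _ _).cons _)), List.mem_cons_of_mem _ h3⟩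

theorem IsWalk.exists_first_descent {h k : ℕ} {L : List ℕ} (hL : IsWalk h L) (hk : k < h) :
    ∃ p q, h :: L = p ++ (k + 1) :: k :: q ∧ ∀ x ∈ p, 1 ≤ x := by
  induction L generalizing h with
  | nil =>
    simp only [IsWalk] at hL
    omega
  | cons a L ih =>
    by_cases ha : k < a
    · obtain ⟨p, q, h1, h2⟩ := ih hL.2 ha
      refine ⟨h :: p, q, by rw [h1]; rfl, ?_⟩
      simp only [List.mem_cons, forall_eq_or_imp]
      exact ⟨by omega, h2⟩
    · have := hL.1
      obtain rfl : a = k := by omega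
      obtain rfl : h = a + 1 := by omega
      exact ⟨[], L, rfl, by simp⟩

/-- Follow the initial ascent. If it reaches k + 1, take the first later descent to k. Otherwise
take the very first descent, which is preceded by up steps only; this fixes the length of p. -/
theorem IsWalk.exists_descent {h k : ℕ} {L : List ℕ} (hL : IsWalk h L) (h1 : 1 ≤ h)
    (hk : h ≤ k + 1) :
    ∃ p s q, h :: L = p ++ (s + 1) :: s :: q ∧ (∀ x ∈ p, 1 ≤ x) ∧ s ≤ k ∧
      (s = k ∨ p.length + h = s + 1) := by
  induction L generalizing h with
  | nil =>
    simp only [IsWalk] at hL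
    omega
  | cons a L ih =>
    by_cases he : h = k + 1
    · obtain ⟨p, q, h2, h3⟩ := hL.exists_first_descent (k := k) (by omega)
      exact ⟨p, k, q, h2, h3, le_rfl, Or.inl rfl⟩
    · rcases hL.1 with rfl | rfl
      · obtain ⟨p, s, q, h2, h3, h4, h5⟩ := ih hL.2 (by omega) (by omega)
        refine ⟨h :: p, s, q, by rw [h2]; rfl, ?_, h4, ?_⟩
        · simp only [List.mem_cons, forall_eq_or_imp]
          exact ⟨h1, h3⟩
        · rw [List.length_cons]
          omega
      · exact ⟨[], a, L, rfl, by simp, by omega, Or.inr (by simp)⟩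

/-- Inverts `liftAt` at a chosen descent, which serves to remove a first edge from a prescribed
height sequence. -/
theorem liftAt_map_pred_append {p : List ℕ} (hp : ∀ x ∈ p, 1 ≤ x) (s : ℕ) (q : List ℕ) :
    liftAt (p.map (· - 1) ++ s :: q) p.length = p ++ (s + 1) :: s :: q := by
  induction p with
  | nil => rfl
  | cons a p ih =>
    simp only [List.mem_cons, forall_eq_or_imp] at hp
    simp [liftAt, ih hp.2, Nat.sub_add_cancel hp.1]

theorem getD_map_pred_append (p : List ℕ) (s : ℕ) (q : List ℕ) :
    (p.map (· - 1) ++ s :: q).getD p.length 0 = s := by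
  simp [List.getD_eq_getElem?_getD]

theorem isWalk_map_pred_append {p : List ℕ} {h s : ℕ} {q L : List ℕ} (hp : ∀ x ∈ p, 1 ≤ x)
    (he : h :: L = p ++ (s + 1) :: s :: q) (hL : IsWalk h L) :
    ∃ L', p.map (· - 1) ++ s :: q = (h - 1) :: L' ∧ IsWalk (h - 1) L' := by
  induction p generalizing h L with
  | nil =>
    simp only [List.nil_append, List.cons.injEq] at he
    obtain ⟨rfl, rfl⟩ := he
    exact ⟨q, rfl, hL.2⟩
  | cons a p ih =>
    simp only [List.mem_cons, forall_eq_or_imp] at hp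
    simp only [List.cons_append, List.cons.injEq] at he
    obtain ⟨rfl, rfl⟩ := he
    obtain ⟨x, L, hx⟩ : ∃ x L, p ++ (s + 1) :: s :: q = x :: L := by
      cases p <;> simp
    have hx1 : 1 ≤ x := by
      cases p with
      | nil => simp at hx; omega
      | cons b p =>
        simp only [List.cons_append, List.cons.injEq] at hx
        exact hx.1 ▸ hp.2 b (by simp)
    rw [hx] at hL
    obtain ⟨L', h1, h2⟩ := ih hp.2 hx.symm hL.2
    have := hL.1
    exact ⟨(x - 1) :: L', by rw [← h1]; rfl, by omega, h2⟩

/-- Insertion of a new peak of height `m + 1`, where `m` is the maximum. -/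
def raise (μ : Multiset ℕ) : Multiset ℕ := (μ.sup + 1) ::ₘ μ.sup ::ₘ μ

/-- Insertion of a new peak of height `m`, where `m` is the maximum. -/
def widen (μ : Multiset ℕ) : Multiset ℕ := μ.sup ::ₘ (μ.sup - 1) ::ₘ μ

/-- The multisets of heights of Dyck paths of semilength `n + 1`. -/
def dyckHeights : ℕ → Finset (Multiset ℕ)
  | 0 => {{0, 0, 1}}
  | n + 1 => (dyckHeights n).image raise ∪ (dyckHeights n).image widen

theorem sup_raise (μ : Multiset ℕ) : (raise μ).sup = μ.sup + 1 := by
  simp only [raise, Multiset.sup_cons]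
  simp

theorem sup_widen (μ : Multiset ℕ) : (widen μ).sup = μ.sup := by
  simp only [widen, Multiset.sup_cons]
  simp

theorem raise_injective : Function.Injective raise := by
  intro μ ν h
  have h1 : μ.sup = ν.sup := by
    have := congrArg Multiset.sup h
    simpa [sup_raise] using this
  simpa [raise, h1] using h

theorem widen_injective : Function.Injective widen := by
  intro μ ν h
  have h1 : μ.sup = ν.sup := by
    have := congrArg Multiset.sup h
    simpa [sup_widen] using this
  simpa [widen, h1] using h

theorem one_le_sup_of_mem_dyckHeights {n : ℕ} {μ : Multiset ℕ} (h : μ ∈ dyckHeights n) :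
    1 ≤ μ.sup := by
  induction n generalizing μ with
  | zero =>
    simp only [dyckHeights, Finset.mem_singleton] at h
    subst h
    decide
  | succ n ih =>
    simp only [dyckHeights, Finset.mem_union, Finset.mem_image] at h
    rcases h with ⟨ν, hν, rfl⟩ | ⟨ν, hν, rfl⟩
    · simp [sup_raise]
    · rw [sup_widen]
      exact ih hν

theorem multiset_sup_mem {μ : Multiset ℕ} (h : 1 ≤ μ.sup) : μ.sup ∈ μ := by
  induction μ using Multiset.induction with
  | empty => simp at h
  | cons a μ ih =>
    rw [Multiset.sup_cons] at h ⊢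
    rcases le_total a μ.sup with h1 | h1
    · rw [sup_eq_right.2 h1] at h ⊢
      exact Multiset.mem_cons_of_mem (ih h)
    · rw [sup_eq_left.2 h1]
      exact Multiset.mem_cons_self a μ

/-- In a common value the two inserted pairs coincide, since the maxima agree. Cancelling them
identifies the two preimages, whose maxima however differ by one. -/
theorem disjoint_raise_widen (n : ℕ) :
    Disjoint ((dyckHeights n).image raise) ((dyckHeights n).image widen) := by
  rw [Finset.disjoint_left]
  intro ν h1 h2
  simp only [Finset.mem_image] at h1 h2
  obtain ⟨μ, hμ, rfl⟩ := h1
  obtain ⟨ν, hν, h⟩ := h2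
  have hs : ν.sup = μ.sup + 1 := by
    have := congrArg Multiset.sup h
    rwa [sup_raise, sup_widen] at this
  have he : ν = μ := by
    simpa [raise, widen, hs] using h
  subst he
  omega

theorem sum_dyckHeights_succ {α : Type*} [AddCommMonoid α] (n : ℕ) (f : Multiset ℕ → α) :
    ∑ μ ∈ dyckHeights (n + 1), f μ =
      ∑ μ ∈ dyckHeights n, f (raise μ) + ∑ μ ∈ dyckHeights n, f (widen μ) := by
  rw [dyckHeights, Finset.sum_union (disjoint_raise_widen n),
    Finset.sum_image raise_injective.injOn, Finset.sum_image widen_injective.injOn]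

theorem card_dyckHeights (n : ℕ) : ((dyckHeights n).card : ℚ) = 2 ^ n := by
  induction n with
  | zero => simp [dyckHeights]
  | succ n ih =>
    have h := sum_dyckHeights_succ n (fun _ => (1 : ℚ))
    simp only [Finset.sum_const, nsmul_eq_mul, mul_one] at h
    rw [h, ih]
    ring

theorem sum_sup_dyckHeights (n : ℕ) :
    ∑ μ ∈ dyckHeights n, (μ.sup : ℚ) = 2 ^ n * (n + 2) / 2 := by
  induction n with
  | zero => simp [dyckHeights]
  | succ n ih =>
    rw [sum_dyckHeights_succ]
    simp only [sup_raise, sup_widen, Nat.cast_add, Nat.cast_one, Finset.sum_add_distrib,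
      Finset.sum_const, nsmul_eq_mul, mul_one, ih, card_dyckHeights]
    ring

/-- With maximum s, `raise` adds 2s + 1 to the sum and `widen` adds 2s - 1, so the recursion needs
only the totals of the maxima. -/
theorem sum_sum_dyckHeights (n : ℕ) :
    ∑ μ ∈ dyckHeights n, (μ.sum : ℚ) = 2 ^ n * (n + 1) * (n + 2) / 2 := by
  induction n with
  | zero => simp [dyckHeights]
  | succ n ih =>
    have h1 : ∀ μ : Multiset ℕ, ((raise μ).sum : ℚ) = μ.sum + 2 * μ.sup + 1 := fun μ => by
      simp [raise]; ring
    have h2 : ∀ μ ∈ dyckHeights n, ((widen μ).sum : ℚ) = μ.sum + 2 * μ.sup - 1 := fun μ hμ => by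
      simp [widen, Nat.cast_sub (one_le_sup_of_mem_dyckHeights hμ)]; ring
    rw [sum_dyckHeights_succ, Finset.sum_congr rfl h2]
    simp only [h1, Finset.sum_add_distrib, Finset.sum_sub_distrib, ← Finset.mul_sum,
      Finset.sum_const, nsmul_eq_mul, mul_one, ih, card_dyckHeights, sum_sup_dyckHeights]
    push_cast
    ring

theorem exists_sum_eq_of_mem_dyckHeights {n : ℕ} {μ : Multiset ℕ} (h : μ ∈ dyckHeights n) :
    ∃ m, μ.sum = n + 1 + 2 * m := by
  induction n generalizing μ with
  | zero =>
    simp only [dyckHeights, Finset.mem_singleton] at h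
    subst h
    exact ⟨0, by simp⟩
  | succ n ih =>
    simp only [dyckHeights, Finset.mem_union, Finset.mem_image] at h
    rcases h with ⟨ν, hν, rfl⟩ | ⟨ν, hν, rfl⟩
    · obtain ⟨m, hm⟩ := ih hν
      refine ⟨m + ν.sup, ?_⟩
      simp only [raise, Multiset.sum_cons, hm]
      ring
    · obtain ⟨m, hm⟩ := ih hν
      have := one_le_sup_of_mem_dyckHeights hν
      refine ⟨m + ν.sup - 1, ?_⟩
      simp only [widen, Multiset.sum_cons, hm]
      omega

/-- Remove a highest peak, of height r. The remaining path has maximum r - 1 or r, which are the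
cases `raise` and `widen`. -/
theorem coe_mem_dyckHeights {n : ℕ} {L : List ℕ} (hL : IsWalk 0 L) (hl : L.length = 2 * (n + 1)) :
    ((0 :: L : List ℕ) : Multiset ℕ) ∈ dyckHeights n := by
  induction n generalizing L with
  | zero =>
    match L, hl with
    | [a, b], _ =>
      obtain ⟨h1, h2, h3⟩ := hL
      simp only [IsWalk] at h3
      obtain rfl : b = 0 := h3
      obtain rfl : a = 1 := by omega
      simp only [dyckHeights, Finset.mem_singleton]
      decide
  | succ n ih =>
    set r := (L : Multiset ℕ).sup with hr
    have hle : ∀ x ∈ L, x ≤ r := fun x hx => Multiset.le_sup (by simpa using hx)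
    have h0 : 1 ≤ r := by
      match L, hl with
      | a :: L', _ =>
        have h1 := hL.1
        have := hle a (by simp)
        omega
    have hrL : r ∈ L := Multiset.mem_coe.1 (multiset_sup_mem h0)
    obtain ⟨L', h1, h2, h3⟩ := hL.exists_remove_peak hrL hle (by omega)
    have hmem := ih h1 (by have := h2.length_eq; simp at this; omega)
    have hμ : ((0 :: L : List ℕ) : Multiset ℕ) =
        r ::ₘ (r - 1) ::ₘ ((0 :: L' : List ℕ) : Multiset ℕ) := by
      rw [Multiset.cons_coe, Multiset.cons_coe, Multiset.coe_eq_coe]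
      exact (h2.cons 0).trans ((List.Perm.swap _ _ _).trans ((List.Perm.swap _ _ _).cons _))
    have hs1 : r - 1 ≤ ((0 :: L' : List ℕ) : Multiset ℕ).sup :=
      Multiset.le_sup (by simpa using h3)
    have hs2 : ((0 :: L' : List ℕ) : Multiset ℕ).sup ≤ r := by
      refine Multiset.sup_le.2 fun x hx => ?_
      simp only [Multiset.mem_coe, List.mem_cons] at hx
      rcases hx with rfl | hx
      · exact Nat.zero_le r
      · exact hle x (h2.mem_iff.2 (by simp [hx]))
    rw [hμ]
    simp only [dyckHeights, Finset.mem_union, Finset.mem_image]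
    rcases Nat.lt_or_ge ((0 :: L' : List ℕ) : Multiset ℕ).sup r with h4 | h4
    · refine Or.inl ⟨_, hmem, ?_⟩
      have h5 : ((0 :: L' : List ℕ) : Multiset ℕ).sup = r - 1 := by omega
      rw [raise, h5, Nat.sub_add_cancel h0]
    · refine Or.inr ⟨_, hmem, ?_⟩
      have h5 : ((0 :: L' : List ℕ) : Multiset ℕ).sup = r := by omega
      rw [widen, h5]

theorem IsWalk.exists_insert {h m : ℕ} {L : List ℕ} (hL : IsWalk h L) (hm : m ∈ h :: L) (x : ℕ)
    (hx : x = m + 1 ∨ m = x + 1) : ∃ L', IsWalk h L' ∧ L'.Perm (x :: m :: L) := by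
  induction L generalizing h with
  | nil =>
    obtain rfl : m = h := by simpa using hm
    exact ⟨[x, m], ⟨hx, by omega, hL⟩, .refl _⟩
  | cons a L ih =>
    by_cases he : m = h
    · subst he
      exact ⟨x :: m :: a :: L, ⟨hx, by omega, hL⟩, .refl _⟩
    · obtain ⟨L', h1, h2⟩ := ih hL.2 (by simpa [he] using hm)
      exact ⟨a :: L', ⟨hL.1, h1⟩, (h2.cons a).trans
        ((List.Perm.swap _ _ _).trans ((List.Perm.swap _ _ _).cons _))⟩

theorem exists_isWalk_of_mem_dyckHeights {n : ℕ} {μ : Multiset ℕ} (h : μ ∈ dyckHeights n) :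
    ∃ L, IsWalk 0 L ∧ L.length = 2 * (n + 1) ∧ ((0 :: L : List ℕ) : Multiset ℕ) = μ := by
  induction n generalizing μ with
  | zero =>
    simp only [dyckHeights, Finset.mem_singleton] at h
    subst h
    exact ⟨[1, 0], by simp [IsWalk], rfl, by decide⟩
  | succ n ih =>
    have key : ∀ ν ∈ dyckHeights n, ∀ x m, m ∈ ν → (x = m + 1 ∨ m = x + 1) →
        ∃ L, IsWalk 0 L ∧ L.length = 2 * (n + 1 + 1) ∧
          ((0 :: L : List ℕ) : Multiset ℕ) = x ::ₘ m ::ₘ ν := by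
      intro ν hν x m hm hx
      obtain ⟨L, h1, h2, rfl⟩ := ih hν
      obtain ⟨L', h3, h4⟩ := h1.exists_insert (by simpa using hm) x hx
      refine ⟨L', h3, by rw [h4.length_eq]; simp; omega, ?_⟩
      rw [Multiset.cons_coe, Multiset.cons_coe, Multiset.coe_eq_coe]
      exact (h4.cons 0).trans ((List.Perm.swap _ _ _).trans ((List.Perm.swap _ _ _).cons _))
    simp only [dyckHeights, Finset.mem_union, Finset.mem_image] at h
    rcases h with ⟨ν, hν, rfl⟩ | ⟨ν, hν, rfl⟩
    · exact key ν hν _ _ (multiset_sup_mem (one_le_sup_of_mem_dyckHeights hν)) (Or.inl rfl)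
    · have h1 := one_le_sup_of_mem_dyckHeights hν
      -- Inserting a valley after a visit to the maximum adds the same two heights as inserting a
      -- peak.
      obtain ⟨L, h2, h3, h4⟩ := key ν hν (ν.sup - 1) ν.sup
        (multiset_sup_mem h1) (Or.inr (by omega))
      exact ⟨L, h2, h3, by rw [h4, widen, Multiset.cons_swap]⟩

end Matching

/-! ### Children of a matching: edges, gap heights and crossings -/

namespace Matching

theorem edges_injective {n : ℕ} : Function.Injective (edges : Matching n → _) :=
  fun _ _ h => Matching.ext (Finpartition.ext h)

instance {n : ℕ} : Finite (Matching n) := Finite.of_injective _ edges_injective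

theorem existsUnique_edge {n : ℕ} (M : Matching n) (v : Fin (2 * n)) :
    ∃! A, A ∈ M.edges ∧ v ∈ A :=
  M.partition.existsUnique_mem (Finset.mem_univ v)

theorem edge_eq_of_mem {n : ℕ} {M : Matching n} {A B : Finset (Fin (2 * n))} (hA : A ∈ M.edges)
    (hB : B ∈ M.edges) {v : Fin (2 * n)} (hvA : v ∈ A) (hvB : v ∈ B) : A = B :=
  (M.existsUnique_edge v).unique ⟨hA, hvA⟩ ⟨hB, hvB⟩

theorem edge_nonempty {n : ℕ} {M : Matching n} {A : Finset (Fin (2 * n))} (hA : A ∈ M.edges) :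
    A.Nonempty :=
  M.partition.nonempty_of_mem_parts hA

/-- The matching with a given set of edges. -/
def ofEdges {n : ℕ} (E : Finset (Finset (Fin (2 * n)))) (h : ∀ v, ∃! A, A ∈ E ∧ v ∈ A)
    (h2 : ∀ A ∈ E, A.card = 2) : Matching n where
  partition := Finpartition.ofExistsUnique E (fun _ _ => Finset.subset_univ _) (fun v _ => h v)
    (fun h0 => by simpa using h2 _ h0)
  card_eq_two := h2

theorem edges_ofEdges {n : ℕ} (E : Finset (Finset (Fin (2 * n))))
    (h : ∀ v, ∃! A, A ∈ E ∧ v ∈ A) (h2 : ∀ A ∈ E, A.card = 2) : (ofEdges E h h2).edges = E := rfl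

/-- The increasing relabelling of the old vertices when a new first edge `{0, i + 1}` is added. -/
def relabel {n : ℕ} (i : Fin (2 * n + 1)) : Fin (2 * n) ↪o Fin (2 * (n + 1)) :=
  (Fin.succAboveOrderEmb i).trans (Fin.succOrderEmb (2 * n + 1))

/-- The second vertex of the new first edge. -/
def newVertex {n : ℕ} (i : Fin (2 * n + 1)) : Fin (2 * (n + 1)) := Fin.succ i

theorem newVertex_injective {n : ℕ} : Function.Injective (newVertex : Fin (2 * n + 1) → _) :=
  Fin.succ_injective _

theorem val_newVertex {n : ℕ} (i : Fin (2 * n + 1)) : (newVertex i : ℕ) = i + 1 := rfl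

theorem val_relabel {n : ℕ} (i : Fin (2 * n + 1)) (v : Fin (2 * n)) :
    (relabel i v : ℕ) = if (v : ℕ) < i then (v : ℕ) + 1 else v + 2 := by
  have h : (relabel i v : ℕ) = (i.succAbove v : ℕ) + 1 := rfl
  rw [h, Fin.succAbove]
  simp only [Fin.lt_def, Fin.val_castSucc]
  split_ifs <;> simp

theorem newVertex_ne_zero {n : ℕ} (i : Fin (2 * n + 1)) : newVertex i ≠ 0 := Fin.succ_ne_zero i

theorem range_relabel {n : ℕ} (i : Fin (2 * n + 1)) :
    Set.range (relabel i) = {0, newVertex i}ᶜ := by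
  ext v
  constructor
  · rintro ⟨w, rfl⟩ h
    have h0 : ((0 : Fin (2 * (n + 1))) : ℕ) = 0 := rfl
    rcases h with h | h
    · have h1 := congrArg Fin.val h
      rw [val_relabel, h0] at h1
      split_ifs at h1
    · have h1 := congrArg Fin.val (Set.mem_singleton_iff.1 h)
      rw [val_relabel, val_newVertex] at h1
      split_ifs at h1 <;> omega
  · intro h
    simp only [Set.mem_compl_iff, Set.mem_insert_iff, Set.mem_singleton_iff, not_or] at h
    obtain ⟨w, rfl⟩ := Fin.exists_succ_eq.2 h.1
    obtain ⟨u, rfl⟩ := Fin.exists_succAbove_eq fun e : w = i => h.2 (e ▸ rfl)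
    exact ⟨u, rfl⟩

theorem eq_or_exists_relabel {n : ℕ} (i : Fin (2 * n + 1)) (v : Fin (2 * (n + 1))) :
    v ∈ ({0, newVertex i} : Finset (Fin (2 * (n + 1)))) ∨ ∃ w, relabel i w = v := by
  by_cases h : v ∈ Set.range (relabel i)
  · exact Or.inr h
  · rw [range_relabel, Set.notMem_compl_iff] at h
    exact Or.inl (by simpa using h)

theorem relabel_not_mem {n : ℕ} (i : Fin (2 * n + 1)) (w : Fin (2 * n)) :
    relabel i w ∉ ({0, newVertex i} : Finset (Fin (2 * (n + 1)))) := by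
  have h : relabel i w ∈ Set.range (relabel i) := ⟨w, rfl⟩
  rw [range_relabel] at h
  simpa using h

theorem image_relabel_injective {n : ℕ} (i : Fin (2 * n + 1)) :
    Function.Injective (Finset.image (relabel i)) :=
  Finset.image_injective (relabel i).injective

theorem image_relabel_ne {n : ℕ} (i : Fin (2 * n + 1)) (B : Finset (Fin (2 * n))) :
    B.image (relabel i) ≠ {0, newVertex i} := by
  intro h
  have h0 : (0 : Fin (2 * (n + 1))) ∈ B.image (relabel i) := by simp [h]
  obtain ⟨w, _, hw⟩ := Finset.mem_image.1 h0
  exact relabel_not_mem i w (by simp [hw])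

/-- The edges of a child. -/
def childEdges {n : ℕ} (M : Matching n) (i : Fin (2 * n + 1)) :
    Finset (Finset (Fin (2 * (n + 1)))) :=
  insert {0, newVertex i} (M.edges.image (Finset.image (relabel i)))

/-- The child of `M` with first edge `{0, i + 1}`. -/
def child {n : ℕ} (M : Matching n) (i : Fin (2 * n + 1)) : Matching (n + 1) :=
  ofEdges (childEdges M i)
    (by
      intro v
      simp only [childEdges, Finset.mem_insert, Finset.mem_image]
      rcases eq_or_exists_relabel i v with hv | ⟨w, rfl⟩
      · refine ⟨{0, newVertex i}, ⟨Or.inl rfl, hv⟩, ?_⟩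
        rintro _ ⟨rfl | ⟨B, hB, rfl⟩, h⟩
        · rfl
        · obtain ⟨w, _, rfl⟩ := Finset.mem_image.1 h
          exact absurd hv (relabel_not_mem i w)
      · obtain ⟨B, ⟨hB, hw⟩, hu⟩ := M.existsUnique_edge w
        refine ⟨B.image (relabel i), ⟨Or.inr ⟨B, hB, rfl⟩, Finset.mem_image_of_mem _ hw⟩, ?_⟩
        rintro _ ⟨rfl | ⟨C, hC, rfl⟩, h⟩
        · exact absurd h (relabel_not_mem i w)
        · rw [(relabel i).injective.mem_finset_image] at h
          rw [hu C ⟨hC, h⟩])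
    (by
      simp only [childEdges, Finset.forall_mem_insert, Finset.forall_mem_image]
      refine ⟨Finset.card_pair (newVertex_ne_zero i).symm, fun B hB => ?_⟩
      rw [Finset.card_image_of_injective _ (relabel i).injective]
      exact M.card_eq_two B hB)

theorem edges_child {n : ℕ} (M : Matching n) (i : Fin (2 * n + 1)) :
    (child M i).edges = insert {0, newVertex i} (M.edges.image (Finset.image (relabel i))) := rfl

theorem isChild_iff {n : ℕ} {M : Matching n} {N : Matching (n + 1)} :
    IsChild M N ↔ ∃ i, child M i = N := by
  constructor
  · rintro ⟨x, φ, hx, hφ, hN⟩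
    obtain ⟨i, rfl⟩ : ∃ i, newVertex i = x := Fin.exists_succ_eq.2 hx
    rw [← range_relabel i] at hφ
    obtain rfl : φ = relabel i :=
      DFunLike.coe_injective ((φ.strictMono.range_inj (relabel i).strictMono).1 hφ)
    exact ⟨i, edges_injective (by rw [hN, edges_child])⟩
  · rintro ⟨i, rfl⟩
    exact ⟨newVertex i, relabel i, newVertex_ne_zero i, range_relabel i, rfl⟩

theorem child_inj {n : ℕ} {M M' : Matching n} {i i' : Fin (2 * n + 1)}
    (h : child M i = child M' i') : M = M' ∧ i = i' := by
  -- The edge through 0 determines the gap; erasing it then recovers the parent.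
  have h1 : ({0, newVertex i} : Finset (Fin (2 * (n + 1)))) = {0, newVertex i'} := by
    refine edge_eq_of_mem (M := child M i) (v := 0) ?_ ?_ (by simp) (by simp)
    · simp [edges_child]
    · rw [h]
      simp [edges_child]
  have h2 : newVertex i = newVertex i' := by
    have : newVertex i ∈ ({0, newVertex i'} : Finset (Fin (2 * (n + 1)))) := by
      rw [← h1]
      simp
    simpa [newVertex_ne_zero] using this
  obtain rfl := newVertex_injective h2
  refine ⟨edges_injective (Finset.image_injective (image_relabel_injective i) ?_), rfl⟩
  have h3 : ∀ K : Matching n, {0, newVertex i} ∉ K.edges.image (Finset.image (relabel i)) := by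
    intro K hK
    obtain ⟨B, _, hB⟩ := Finset.mem_image.1 hK
    exact image_relabel_ne i B hB
  have h4 := congrArg (fun K => K.edges.erase {0, newVertex i}) h
  simpa only [edges_child, Finset.erase_insert (h3 _)] using h4

theorem exists_child_eq {n : ℕ} (N : Matching (n + 1)) : ∃ M i, child M i = N := by
  obtain ⟨A, ⟨hA, hA0⟩, -⟩ := N.existsUnique_edge 0
  obtain ⟨x, hx, rfl⟩ : ∃ x, x ≠ 0 ∧ A = {0, x} := by
    obtain ⟨a, b, hab, rfl⟩ := Finset.card_eq_two.1 (N.card_eq_two A hA)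
    simp only [Finset.mem_insert, Finset.mem_singleton] at hA0
    rcases hA0 with rfl | rfl
    · exact ⟨b, hab.symm, rfl⟩
    · exact ⟨a, hab, Finset.pair_comm _ _⟩
  obtain ⟨i, rfl⟩ : ∃ i, newVertex i = x := Fin.exists_succ_eq.2 hx
  have key : ∀ C ∈ N.edges, C = {0, newVertex i} ∨ ∃ B, Finset.image (relabel i) B = C := by
    intro C hC
    by_cases h : C = {0, newVertex i}
    · exact Or.inl h
    · refine Or.inr ⟨Finset.univ.filter fun v => relabel i v ∈ C, ?_⟩
      ext v
      simp only [Finset.mem_image, Finset.mem_filter, Finset.mem_univ, true_and]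
      constructor
      · rintro ⟨w, hw, rfl⟩
        exact hw
      · intro hv
        rcases eq_or_exists_relabel i v with h1 | ⟨w, rfl⟩
        · exact absurd (edge_eq_of_mem hC hA hv h1) h
        · exact ⟨w, hv, rfl⟩
  refine ⟨ofEdges (Finset.univ.filter fun B => Finset.image (relabel i) B ∈ N.edges) ?_ ?_, i,
    edges_injective ?_⟩
  · intro v
    simp only [Finset.mem_filter, Finset.mem_univ, true_and]
    obtain ⟨C, ⟨hC, hv⟩, -⟩ := N.existsUnique_edge (relabel i v)
    rcases key C hC with rfl | ⟨B, rfl⟩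
    · exact absurd hv (relabel_not_mem i v)
    · refine ⟨B, ⟨hC, (relabel i).injective.mem_finset_image.1 hv⟩, ?_⟩
      rintro B' ⟨hB', hv'⟩
      exact image_relabel_injective i
        (edge_eq_of_mem hB' hC (Finset.mem_image_of_mem _ hv') hv)
  · intro B hB
    rw [← Finset.card_image_of_injective _ (relabel i).injective]
    exact N.card_eq_two _ (Finset.mem_filter.1 hB).2
  · ext C
    simp only [edges_child, edges_ofEdges, Finset.mem_insert, Finset.mem_image,
      Finset.mem_filter, Finset.mem_univ, true_and]
    constructor
    · rintro (rfl | ⟨B, hB, rfl⟩)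
      · exact hA
      · exact hB
    · intro hC
      rcases key C hC with rfl | ⟨B, rfl⟩
      · exact Or.inl rfl
      · exact Or.inr ⟨B, hC, rfl⟩

/-- `A` covers the gap in front of the vertex `g`. -/
def Covers {m : ℕ} (A : Finset (Fin m)) (g : ℕ) : Prop :=
  (∃ a ∈ A, (a : ℕ) < g) ∧ ∃ b ∈ A, g ≤ (b : ℕ)

open scoped Classical in
/-- The number of edges that cover the gap in front of the vertex `g`. -/
noncomputable def height {n : ℕ} (M : Matching n) (g : ℕ) : ℕ :=
  (M.edges.filter fun A => Covers A g).card

/-- The sequence of the heights of all gaps. -/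
noncomputable def heights {n : ℕ} (M : Matching n) : List ℕ :=
  (List.range (2 * n + 1)).map M.height

theorem covers_image_relabel {n : ℕ} (i : Fin (2 * n + 1)) (B : Finset (Fin (2 * n))) (g : ℕ) :
    Covers (B.image (relabel i)) (g + 1) ↔ Covers B (if g ≤ i then g else g - 1) := by
  have h1 : ∀ w, (relabel i w : ℕ) < g + 1 ↔ (w : ℕ) < if g ≤ i then g else g - 1 := fun w => by
    rw [val_relabel]
    split_ifs <;> omega
  have h2 : ∀ w, g + 1 ≤ (relabel i w : ℕ) ↔ (if g ≤ i then g else g - 1) ≤ (w : ℕ) := fun w => by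
    rw [val_relabel]
    split_ifs <;> omega
  simp only [Covers, Finset.exists_mem_image, h1, h2]

theorem covers_newEdge {n : ℕ} (i : Fin (2 * n + 1)) (g : ℕ) :
    Covers ({0, newVertex i} : Finset (Fin (2 * (n + 1)))) (g + 1) ↔ g ≤ i := by
  simp [Covers, val_newVertex]

theorem height_zero {n : ℕ} (M : Matching n) : M.height 0 = 0 := by
  simp [height, Covers]

/-- The new vertex splits gap i in two, which shifts the later gaps; the new edge covers precisely
the gaps after 0 up to the left half of gap i. -/
theorem height_child {n : ℕ} (M : Matching n) (i : Fin (2 * n + 1)) (g : ℕ) :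
    (child M i).height (g + 1) = if g ≤ i then M.height g + 1 else M.height (g - 1) := by
  classical
  have h3 : ∀ p : Finset (Fin (2 * (n + 1))) → Prop, {0, newVertex i} ∉
      (M.edges.image (Finset.image (relabel i))).filter p := by
    intro p hK
    obtain ⟨B, _, hB⟩ := Finset.mem_image.1 (Finset.mem_filter.1 hK).1
    exact image_relabel_ne i B hB
  rw [height, edges_child, Finset.filter_insert]
  simp only [covers_newEdge]
  have e : ((M.edges.image (Finset.image (relabel i))).filter fun A => Covers A (g + 1)).card =
      M.height (if g ≤ i then g else g - 1) := by
    rw [Finset.filter_image, Finset.card_image_of_injective _ (image_relabel_injective i), height]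
    simp only [covers_image_relabel]
  split_ifs with h
  · rw [Finset.card_insert_of_notMem (h3 _), e, if_pos h]
  · rw [e, if_neg h]

theorem getElem?_liftAt (L : List ℕ) (i g : ℕ) (hi : i < L.length) :
    (liftAt L i)[g]? = if g ≤ i then L[g]?.map (· + 1) else L[g - 1]? := by
  induction L generalizing i g with
  | nil => simp at hi
  | cons a L ih =>
    cases i with
    | zero =>
      cases g with
      | zero => simp [liftAt]
      | succ g => simp [liftAt]
    | succ i =>
      cases g with
      | zero => simp [liftAt]
      | succ g =>
        simp only [liftAt, List.getElem?_cons_succ, ih i g (by simpa using hi)]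
        by_cases h : g ≤ i
        · simp [h]
        · obtain ⟨g, rfl⟩ : ∃ g', g = g' + 1 := ⟨g - 1, by omega⟩
          simp [h]

theorem length_heights {n : ℕ} (M : Matching n) : M.heights.length = 2 * n + 1 := by
  simp [heights]

theorem getD_heights {n : ℕ} (M : Matching n) {i : ℕ} (hi : i < 2 * n + 1) :
    M.heights.getD i 0 = M.height i := by
  simp [heights, List.getD_eq_getElem?_getD, hi]

theorem heights_child {n : ℕ} (M : Matching n) (i : Fin (2 * n + 1)) :
    (child M i).heights = 0 :: liftAt M.heights i := by
  refine List.ext_getElem? fun g => ?_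
  cases g with
  | zero => simp [heights, height_zero]
  | succ g =>
    rw [List.getElem?_cons_succ, getElem?_liftAt _ _ _ (by rw [length_heights]; exact i.2)]
    have hi := i.2
    have e : ∀ {m : ℕ} (K : Matching m) (j : ℕ),
        K.heights[j]? = if j < 2 * m + 1 then some (K.height j) else none := fun K j => by
      simp only [heights, List.getElem?_map]
      split_ifs with h <;> simp [h]
    simp only [e, height_child]
    split_ifs <;> first | rfl | omega

theorem isLeast_image_relabel {n : ℕ} (i : Fin (2 * n + 1)) (B : Finset (Fin (2 * n)))
    (a : Fin (2 * (n + 1))) :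
    IsLeast (B.image (relabel i) : Set (Fin (2 * (n + 1)))) a ↔
      ∃ b, IsLeast (B : Set (Fin (2 * n))) b ∧ relabel i b = a := by
  simp only [IsLeast, lowerBounds, Finset.coe_image, Set.mem_image, Set.mem_ofPred_eq]
  constructor
  · rintro ⟨⟨b, hb, rfl⟩, h⟩
    exact ⟨b, ⟨hb, fun c hc => (relabel i).le_iff_le.1 (h ⟨c, hc, rfl⟩)⟩, rfl⟩
  · rintro ⟨b, ⟨hb, h⟩, rfl⟩
    refine ⟨⟨b, hb, rfl⟩, ?_⟩
    rintro _ ⟨c, hc, rfl⟩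
    exact (relabel i).le_iff_le.2 (h hc)

theorem isGreatest_image_relabel {n : ℕ} (i : Fin (2 * n + 1)) (B : Finset (Fin (2 * n)))
    (a : Fin (2 * (n + 1))) :
    IsGreatest (B.image (relabel i) : Set (Fin (2 * (n + 1)))) a ↔
      ∃ b, IsGreatest (B : Set (Fin (2 * n))) b ∧ relabel i b = a := by
  simp only [IsGreatest, upperBounds, Finset.coe_image, Set.mem_image, Set.mem_ofPred_eq]
  constructor
  · rintro ⟨⟨b, hb, rfl⟩, h⟩
    exact ⟨b, ⟨hb, fun c hc => (relabel i).le_iff_le.1 (h ⟨c, hc, rfl⟩)⟩, rfl⟩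
  · rintro ⟨b, ⟨hb, h⟩, rfl⟩
    refine ⟨⟨b, hb, rfl⟩, ?_⟩
    rintro _ ⟨c, hc, rfl⟩
    exact (relabel i).le_iff_le.2 (h hc)

theorem crossesFromLeft_image_relabel {n : ℕ} (i : Fin (2 * n + 1)) (A B : Finset (Fin (2 * n))) :
    CrossesFromLeft (A.image (relabel i)) (B.image (relabel i)) ↔ CrossesFromLeft A B := by
  simp only [CrossesFromLeft, isLeast_image_relabel, isGreatest_image_relabel]
  constructor
  · rintro ⟨_, _, _, _, ⟨a, ha, rfl⟩, ⟨b, hb, rfl⟩, ⟨c, hc, rfl⟩, ⟨d, hd, rfl⟩, h⟩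
    simp only [OrderEmbedding.lt_iff_lt] at h
    exact ⟨a, b, c, d, ha, hb, hc, hd, h⟩
  · rintro ⟨a, b, c, d, ha, hb, hc, hd, h⟩
    refine ⟨_, _, _, _, ⟨a, ha, rfl⟩, ⟨b, hb, rfl⟩, ⟨c, hc, rfl⟩, ⟨d, hd, rfl⟩, ?_⟩
    simpa only [OrderEmbedding.lt_iff_lt] using h

theorem isLeast_newEdge {n : ℕ} (i : Fin (2 * n + 1)) :
    IsLeast (({0, newVertex i} : Finset (Fin (2 * (n + 1)))) : Set (Fin (2 * (n + 1)))) 0 :=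
  ⟨by simp, fun x _ => Fin.zero_le x⟩

theorem isGreatest_newEdge {n : ℕ} (i : Fin (2 * n + 1)) :
    IsGreatest (({0, newVertex i} : Finset (Fin (2 * (n + 1)))) : Set (Fin (2 * (n + 1))))
      (newVertex i) := by
  refine ⟨by simp, fun x hx => ?_⟩
  simp only [Finset.coe_insert, Finset.coe_singleton, Set.mem_insert_iff,
    Set.mem_singleton_iff] at hx
  rcases hx with rfl | rfl
  · exact Fin.zero_le _
  · exact le_rfl

theorem not_crossesFromLeft_newEdge {n : ℕ} (i : Fin (2 * n + 1))
    (A : Finset (Fin (2 * (n + 1)))) : ¬ CrossesFromLeft A {0, newVertex i} := by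
  rintro ⟨a, b, c, d, -, hb, -, -, hab, -⟩
  rw [hb.unique (isLeast_newEdge i)] at hab
  exact Fin.not_lt_zero _ hab

theorem crossesFromLeft_newEdge {n : ℕ} (i : Fin (2 * n + 1)) {B : Finset (Fin (2 * n))}
    (hB : B.Nonempty) :
    CrossesFromLeft {0, newVertex i} (B.image (relabel i)) ↔ Covers B i := by
  have h1 : ∀ w, relabel i w < newVertex i ↔ (w : ℕ) < i := fun w => by
    rw [Fin.lt_def, val_relabel, val_newVertex]
    split_ifs <;> omega
  have h2 : ∀ w, newVertex i < relabel i w ↔ (i : ℕ) ≤ w := fun w => by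
    rw [Fin.lt_def, val_relabel, val_newVertex]
    split_ifs <;> omega
  constructor
  · rintro ⟨a, b, c, d, ha, hb, hc, hd, hab, hbc, hcd⟩
    obtain ⟨b, hb', rfl⟩ := (isLeast_image_relabel i B b).1 hb
    obtain ⟨d, hd', rfl⟩ := (isGreatest_image_relabel i B d).1 hd
    obtain rfl := hc.unique (isGreatest_newEdge i)
    exact ⟨⟨b, hb'.1, (h1 b).1 hbc⟩, d, hd'.1, (h2 d).1 hcd⟩
  · rintro ⟨⟨b, hb, hbi⟩, d, hd, hdi⟩
    refine ⟨0, relabel i (B.min' hB), newVertex i, relabel i (B.max' hB), isLeast_newEdge i,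
      (isLeast_image_relabel _ _ _).2 ⟨_, B.isLeast_min' hB, rfl⟩, isGreatest_newEdge i,
      (isGreatest_image_relabel _ _ _).2 ⟨_, B.isGreatest_max' hB, rfl⟩, ?_, ?_, ?_⟩
    · refine Fin.pos_iff_ne_zero.2 fun h => relabel_not_mem i (B.min' hB) ?_
      simp [h]
    · exact (h1 _).2 (lt_of_le_of_lt (Fin.le_def.1 (B.min'_le b hb)) hbi)
    · exact (h2 _).2 (hdi.trans (Fin.le_def.1 (B.le_max' d hd)))

/-- Relabelling preserves the old crossings. The new edge starts first, so it crosses exactly the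
edges that cover gap i. -/
theorem cr_child {n : ℕ} (M : Matching n) (i : Fin (2 * n + 1)) :
    (child M i).cr = M.cr + M.height i := by
  classical
  have hinj := image_relabel_injective i
  have h : {p : Finset (Fin (2 * (n + 1))) × Finset (Fin (2 * (n + 1))) |
      p.1 ∈ (child M i).edges ∧ p.2 ∈ (child M i).edges ∧ CrossesFromLeft p.1 p.2} =
      Prod.map (Finset.image (relabel i)) (Finset.image (relabel i)) ''
        {p | p.1 ∈ M.edges ∧ p.2 ∈ M.edges ∧ CrossesFromLeft p.1 p.2} ∪
      (fun B : Finset (Fin (2 * n)) => ({0, newVertex i}, B.image (relabel i))) ''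
        (M.edges.filter fun B => Covers B i : Finset _) := by
    ext ⟨A, B⟩
    simp only [edges_child, Set.mem_ofPred_eq, Set.mem_union, Set.mem_image, Finset.mem_coe,
      Finset.mem_filter, Finset.mem_insert, Finset.mem_image, Prod.exists, Prod.map_apply,
      Prod.mk.injEq]
    constructor
    · rintro ⟨hA, rfl | ⟨B, hB, rfl⟩, hc⟩
      · exact absurd hc (not_crossesFromLeft_newEdge i _)
      · rcases hA with rfl | ⟨A, hA, rfl⟩
        · exact Or.inr ⟨B, ⟨hB, (crossesFromLeft_newEdge i (edge_nonempty hB)).1 hc⟩, rfl, rfl⟩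
        · exact Or.inl ⟨A, B, ⟨hA, hB, (crossesFromLeft_image_relabel i A B).1 hc⟩, rfl, rfl⟩
    · rintro (⟨A, B, ⟨hA, hB, hc⟩, rfl, rfl⟩ | ⟨B, ⟨hB, hc⟩, rfl, rfl⟩)
      · exact ⟨Or.inr ⟨A, hA, rfl⟩, Or.inr ⟨B, hB, rfl⟩,
          (crossesFromLeft_image_relabel i A B).2 hc⟩
      · exact ⟨Or.inl rfl, Or.inr ⟨B, hB, rfl⟩,
          (crossesFromLeft_newEdge i (edge_nonempty hB)).2 hc⟩
  rw [cr, h, Set.ncard_union_eq, Set.ncard_image_of_injective _ (hinj.prodMap hinj),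
    Set.ncard_image_of_injective _ (fun B C h => hinj (Prod.ext_iff.1 h).2), Set.ncard_coe_finset]
  · rfl
  · rw [Set.disjoint_left]
    rintro _ ⟨⟨A, B⟩, -, rfl⟩ ⟨C, -, h⟩
    exact image_relabel_ne i A (Prod.ext_iff.1 h).1.symm

end Matching

/-! ### Level distributions and the classification of similarity -/

namespace Matching

open Polynomial

/-- The `l`-th level of the subtree rooted in `M`, as a `Finset`. -/
noncomputable def levelFinset {n : ℕ} (M : Matching n) (l : ℕ) : Finset (Matching (n + l)) :=
  (Set.toFinite (level M l)).toFinset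

theorem sum_levelFinset_succ {n : ℕ} (M : Matching n) (l : ℕ) (f : Matching (n + l + 1) → ℤ[X]) :
    ∑ K ∈ levelFinset M (l + 1), f K =
      ∑ K ∈ levelFinset M l, ∑ i : Fin (2 * (n + l) + 1), f (child K i) := by
  classical
  have h : levelFinset M (l + 1) =
      (levelFinset M l ×ˢ (Finset.univ : Finset (Fin (2 * (n + l) + 1)))).image
        (fun p => child p.1 p.2) := by
    ext N
    simp only [levelFinset, Set.Finite.mem_toFinset, Finset.mem_image, Finset.mem_product,
      Finset.mem_univ, and_true, Prod.exists, level, Set.mem_ofPred_eq]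
    constructor
    · rintro ⟨K, hK, hN⟩
      obtain ⟨i, rfl⟩ := isChild_iff.1 hN
      exact ⟨K, i, hK, rfl⟩
    · rintro ⟨K, i, hK, rfl⟩
      exact ⟨K, hK, isChild_iff.2 ⟨i, rfl⟩⟩
  rw [h, Finset.sum_image, Finset.sum_product]
  intro p _ q _ hpq
  exact Prod.ext (child_inj hpq).1 (child_inj hpq).2

theorem sum_child {n : ℕ} (M : Matching n) (f : List ℕ → ℤ[X]) :
    ∑ i : Fin (2 * n + 1), X ^ (child M i).cr * f (child M i).heights =
      X ^ M.cr * childSum f M.heights := by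
  rw [childSum_apply, length_heights, Finset.sum_range, Finset.mul_sum]
  refine Finset.sum_congr rfl fun i _ => ?_
  rw [cr_child, heights_child, getD_heights M i.2, pow_add, mul_assoc]

/-- The extra parameter m lets the induction trade one level of the tree for one application of
`childSum`; the case m = 0 is the generating function of level l. -/
theorem sum_level {n : ℕ} (M : Matching n) (l m : ℕ) :
    ∑ K ∈ levelFinset M l, X ^ K.cr * levelPoly m K.heights =
      X ^ M.cr * levelPoly (l + m) M.heights := by
  induction l generalizing m with
  | zero =>
    have h : levelFinset M 0 = {M} := by
      ext K
      simp only [levelFinset, Set.Finite.mem_toFinset, level, Finset.mem_singleton]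
      exact Iff.rfl
    rw [h, zero_add]
    exact Finset.sum_singleton _ _
  | succ l ih =>
    rw [sum_levelFinset_succ M l (fun K => X ^ K.cr * levelPoly m K.heights),
      show l + 1 + m = l + (m + 1) by ring, ← ih, levelPoly_succ]
    exact Finset.sum_congr rfl fun K _ => sum_child K _

theorem ncard_level {n : ℕ} (M : Matching n) (l k : ℕ) :
    (({K ∈ level M l | cr K = k}.ncard : ℕ) : ℤ) =
      (X ^ M.cr * levelPoly l M.heights).coeff k := by
  classical
  have h := sum_level M l 0
  have h1 : ∀ L, levelPoly 0 L = 1 := fun L => by simp [levelPoly]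
  simp only [h1, mul_one, add_zero] at h
  rw [← h, finsetSum_coeff]
  simp only [coeff_X_pow]
  rw [Finset.sum_boole]
  have h2 : {K ∈ level M l | cr K = k} =
      (((levelFinset M l).filter fun K => k = cr K : Finset _) : Set _) := by
    ext K
    simp [levelFinset, eq_comm]
  rw [h2, Set.ncard_coe_finset]

theorem crossingSimilar_iff {n : ℕ} (M N : Matching n) :
    CrossingSimilar M N ↔ M.heights.Perm N.heights ∧ M.cr = N.cr := by
  have hiff : CrossingSimilar M N ↔
      ∀ l, X ^ M.cr * levelPoly l M.heights = X ^ N.cr * levelPoly l N.heights := by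
    refine forall_congr' fun l => ?_
    rw [Polynomial.ext_iff]
    refine forall_congr' fun k => ?_
    rw [← ncard_level, ← ncard_level, Nat.cast_inj]
  rw [hiff]
  constructor
  · intro h
    have h0 := h 0
    simp only [levelPoly, pow_zero, Module.End.one_apply, Pi.one_apply, mul_one] at h0
    have hcr : M.cr = N.cr := by simpa using congrArg natDegree h0
    have h1 := h 1
    rw [hcr] at h1
    have h2 := mul_left_cancel₀ (pow_ne_zero _ X_ne_zero) h1
    refine ⟨List.perm_iff_count.2 fun k => ?_, hcr⟩
    rw [← Nat.cast_inj (R := ℤ), ← coeff_levelPoly_one, ← coeff_levelPoly_one, h2]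
  · rintro ⟨h1, h2⟩ l
    rw [h2, levelPoly_eq_of_perm l h1]

/-! ### Which pairs of heights and crossing number occur, and their count -/

theorem heights_of_zero (M : Matching 0) : M.heights = [0] := by
  simp [heights, height_zero]

theorem edges_of_zero (M : Matching 0) : M.edges = ∅ := by
  refine Finset.eq_empty_of_forall_notMem fun A hA => ?_
  obtain ⟨a, -⟩ := edge_nonempty hA
  exact absurd a.2 (by simp)

theorem cr_of_zero (M : Matching 0) : M.cr = 0 := by
  simp [cr, edges_of_zero]

/-- For the bound, a new edge at gap i adds a_i crossings and a_i + i + 1 to the height sum; since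
a_i ≤ i, the sum grows by at least 2 a_i + 1. -/
theorem exists_heights_eq_cons {n : ℕ} (M : Matching n) :
    ∃ L, M.heights = 0 :: L ∧ IsWalk 0 L ∧ L.length = 2 * n ∧ n + 2 * M.cr ≤ L.sum := by
  induction n with
  | zero => exact ⟨[], heights_of_zero M, rfl, rfl, by simp [cr_of_zero]⟩
  | succ n ih =>
    obtain ⟨M, i, rfl⟩ := exists_child_eq M
    obtain ⟨L, h1, h2, h3, h4⟩ := ih M
    have hi := i.2
    obtain ⟨L', h5, h6⟩ := h2.liftAt (i := i) (by omega)
    have h7 := sum_liftAt (0 :: L) i (by simp; omega)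
    have h8 := h2.getD_le i
    have h9 := getD_heights M hi
    have h10 : ∀ (K : List ℕ) i, i < K.length → (liftAt K i).length = K.length + 1 := by
      intro K
      induction K with
      | nil => simp
      | cons a K ih =>
        rintro (_ | i) hi
        · rfl
        · simp only [liftAt, List.length_cons, ih i (by simpa using hi)]
    have h11 := h10 (0 :: L) i (by simp; omega)
    rw [h1] at h9
    refine ⟨_, by rw [heights_child, h1], ?_, ?_, ?_⟩
    · rw [h5]
      exact ⟨by simp, h6⟩
    · rw [h11, List.length_cons, h3]
      ring
    · rw [cr_child, h7, h9, List.sum_cons]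
      rw [h9] at h8
      omega

theorem le_sum_of_isWalk {n : ℕ} {L : List ℕ} (hL : IsWalk 0 L) (hl : L.length = 2 * n) :
    n ≤ L.sum := by
  cases n with
  | zero => simp
  | succ n =>
    obtain ⟨m, hm⟩ := exists_sum_eq_of_mem_dyckHeights (coe_mem_dyckHeights hL hl)
    simp only [Multiset.sum_coe, List.sum_cons] at hm
    omega

/-- Greedy choice of the first edge: it ends at a descent from s + 1 to s and so takes s ≤ k of the
crossings, leaving k - s for the smaller matching. -/
theorem exists_heights_eq {n k : ℕ} {L : List ℕ} (hL : IsWalk 0 L) (hl : L.length = 2 * n)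
    (hk : n + 2 * k ≤ L.sum) : ∃ M : Matching n, M.heights = 0 :: L ∧ M.cr = k := by
  induction n generalizing L k with
  | zero =>
    obtain rfl : L = [] := List.length_eq_zero_iff.1 hl
    let M : Matching 0 := ofEdges ∅ (fun v => absurd v.2 (by simp)) (by simp)
    refine ⟨M, heights_of_zero M, ?_⟩
    rw [cr_of_zero]
    simp at hk
    omega
  | succ n ih =>
    match L, hl with
    | a :: L, hl =>
      obtain rfl : a = 1 := by have := hL.1; omega
      obtain ⟨p, s, q, h1, h2, h3, h4⟩ := hL.2.exists_descent (k := k) le_rfl (by omega)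
      obtain ⟨V, h5, h6⟩ := isWalk_map_pred_append h2 h1 hL.2
      have h7 := congrArg List.length h1
      have h8 := congrArg List.length h5
      simp only [List.length_append, List.length_cons, List.length_map] at h7 h8 hl
      have h9 := liftAt_map_pred_append h2 s q
      have h10 := getD_map_pred_append p s q
      have h11 := sum_liftAt (p.map (· - 1) ++ s :: q) p.length (by simp)
      rw [h9, ← h1, h10] at h11
      rw [h5] at h9 h10 h11
      have hV := le_sum_of_isWalk (n := n) h6 (by omega)
      simp only [List.sum_cons] at h11 hk
      -- If s = k, no crossings are left and `hV` suffices. Otherwise the prefix has length s, so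
      -- the height sum drops by exactly 2s + 1 and the bound is inherited.
      obtain ⟨M, hM1, hM2⟩ := ih (k := k - s) h6 (by omega) (by omega)
      have hi : p.length < 2 * n + 1 := by omega
      refine ⟨child M ⟨p.length, hi⟩, ?_, ?_⟩
      · rw [heights_child, hM1, h1]
        exact congrArg _ h9
      · have h12 := getD_heights M hi
        rw [hM1] at h12
        rw [cr_child, hM2, ← h12]
        simp only [Nat.sub_self] at h10
        rw [h10]
        omega

/-- The invariant that classifies matchings up to crossing-similarity. -/
noncomputable def invariant {n : ℕ} (M : Matching n) : (_ : Multiset ℕ) × ℕ :=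
  ⟨(M.heights : Multiset ℕ), M.cr⟩

theorem crossingSetoid_eq_ker (n : ℕ) :
    crossingSetoid n = Setoid.ker (invariant : Matching n → _) := by
  ext M N
  rw [Setoid.ker_def]
  change CrossingSimilar M N ↔ _
  simp [crossingSimilar_iff, invariant, Multiset.coe_eq_coe]

theorem range_invariant (n : ℕ) :
    Set.range (invariant : Matching (n + 1) → _) =
      ((dyckHeights n).sigma fun μ => Finset.range ((μ.sum - (n + 1)) / 2 + 1) : Finset _) := by
  ext ⟨μ, k⟩
  simp only [Set.mem_range, Finset.coe_sigma, Set.mem_sigma_iff, Finset.mem_coe, Finset.mem_range,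
    invariant, Sigma.mk.injEq, heq_eq_eq]
  constructor
  · rintro ⟨M, rfl, rfl⟩
    obtain ⟨L, h1, h2, h3, h4⟩ := exists_heights_eq_cons M
    rw [h1]
    refine ⟨coe_mem_dyckHeights h2 h3, ?_⟩
    simp only [Multiset.sum_coe, List.sum_cons]
    omega
  · rintro ⟨h1, h2⟩
    obtain ⟨L, h3, h4, rfl⟩ := exists_isWalk_of_mem_dyckHeights h1
    obtain ⟨m, hm⟩ := exists_sum_eq_of_mem_dyckHeights h1
    simp only [Multiset.sum_coe, List.sum_cons] at h2 hm
    obtain ⟨M, h5, h6⟩ := exists_heights_eq (k := k) h3 h4 (by omega)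
    exact ⟨M, by rw [h5], h6⟩

theorem card_quotient (n : ℕ) :
    (Nat.card (Quotient (crossingSetoid (n + 1))) : ℚ) =
      2 ^ n * (((n + 1).choose 2 : ℚ) + 2) / 2 := by
  rw [crossingSetoid_eq_ker, Nat.card_congr (Setoid.quotientKerEquivRange _), range_invariant,
    Nat.card_coe_set_eq, Set.ncard_coe_finset, Finset.card_sigma]
  -- With height sum n + 1 + 2m the fibre has m + 1 elements. This is affine in the sum, so the
  -- total needs only the sum of all height sums and the number of multisets.
  have h : ∀ μ ∈ dyckHeights n, (((μ.sum - (n + 1)) / 2 + 1 : ℕ) : ℚ) =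
      (μ.sum : ℚ) / 2 - ((n : ℚ) - 1) / 2 := by
    intro μ hμ
    obtain ⟨m, hm⟩ := exists_sum_eq_of_mem_dyckHeights hμ
    have h1 : (μ.sum - (n + 1)) / 2 = m := by omega
    rw [h1, hm]
    push_cast
    ring
  simp only [Finset.card_range]
  rw [Nat.cast_sum, Finset.sum_congr rfl h, Finset.sum_sub_distrib, ← Finset.sum_div,
    sum_sum_dyckHeights, Finset.sum_const, nsmul_eq_mul, card_dyckHeights, Nat.cast_choose_two]
  push_cast
  ring

end Matching

theorem mainTheorem4 (n : ℕ) (hn : 1 ≤ n) :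
    (Nat.card (Quotient (Matching.crossingSetoid n)) : ℚ) =
      (2 : ℚ) ^ ((n : ℤ) - 2) * ((n.choose 2 : ℚ) + 2) := by
  obtain ⟨n, rfl⟩ := Nat.exists_eq_add_of_le' hn
  rw [Matching.card_quotient]
  have h : (((n + 1 : ℕ) : ℤ) - 2) = (n : ℤ) - 1 := by
    push_cast
    ring
  rw [h, zpow_sub₀ two_ne_zero, zpow_natCast, zpow_one]
  ring
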